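/- Let $r\ge 2$ and $l\ge 2(r+1)$ be integers. The hyperweb ${}^r\overline{W}_l^{\,r}$ is the $r$-uniform hypergraph on $l$ vertices placed in a cycle whose edges are exactly the $r$-element sets of vertices contained in some $r+1$ cyclically consecutive vertices. For an $r$-uniform hypergraph $G$, an $a$-clique of $G$ is a set of $a$ vertices all of whose $r$-element subsets are edges of $G$; let $\mathscr{Q}^{a}_{G}$ denote the set of all $a$-cliques of $G$. The Turán polytope $T(G,a,r)\subseteq\mathbb{R}^{E(G)}$ is the convex hull of the characteristic vectors of all edge sets $F\subseteq E(G)$ that contain no $a$-clique. For $x\in\mathbb{R}^{E(G)}$ and a clique $Q$ of $G$, let $x(Q)$ be the sum of $x_e$ over the edges $e$ contained in $Q$, and let $x(G)=\sum_{e\in E(G)}x_e$. Theorem. With $W={}^r\overline{W}_l^{\,r}$, $$T(W,r+1,r)=\Big\{x\in\mathbb{R}^{E(W)}\ :\ x(Q)\le r\ \ \forall Q\in\mathscr{Q}^{r+1}_{W},\quad x(W)\le r\,l-\Big\lceil\frac{l}{2}\Big\rceil,\quad 0\le x_e\le 1\ \ \forall e\in E(W)\Big\}.$$ Moreover, if $l$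 is odd, all of these inequalities are necessary: for each single inequality of the system (each clique inequality, the hyperweb inequality, each inequality $x_e\ge 0$, and each inequality $x_e\le 1$) there is a point outside $T(W,r+1,r)$ that satisfies all the other inequalities. -/

import Mathlib

/-- An `r`-uniform hypergraph on the vertex set `V`, with finitely many edges. -/
structure UniformHypergraph (V : Type*) (r : ℕ) where
  edges : Finset (Finset V)
  card_of_mem : ∀ e ∈ edges, e.card = r

namespace UniformHypergraph

/-- The (vertex sets of) hypercliques of size `i` in `H`: the `i`-sets of vertices all of whose
`r`-subsets are edges of `H`. -/
def cliques {V : Type*} {r : ℕ} (H : UniformHypergraph V r) (i : ℕ) : Set (Finset V) :=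
  {Q | Q.card = i ∧ Finset.powersetCard r Q ⊆ H.edges}

/-- `x(S)`: the sum of `x_e` over the edges `e` of `H` whose vertices all lie in `S`. -/
def edgeSum {V : Type*} [DecidableEq V] {r : ℕ} (H : UniformHypergraph V r)
    (x : H.edges → ℝ) (S : Finset V) : ℝ :=
  ∑ e : H.edges, if (e : Finset V) ⊆ S then x e else 0

/-- The Turán polytope `T(H, a, r)`, in the space `ℝ^E(H)`: the convex hull of the characteristic
vectors of the edge sets `F ⊆ E(H)` that contain no hyperclique of size `a`. -/
def turanPolytope {V : Type*} [DecidableEq V] {r : ℕ} (H : UniformHypergraph V r) (a : ℕ) :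
    Set (H.edges → ℝ) :=
  convexHull ℝ {x | ∃ F : UniformHypergraph V r, F.edges ⊆ H.edges ∧ F.cliques a = ∅ ∧
    x = fun e : H.edges => if (e : Finset V) ∈ F.edges then 1 else 0}

end UniformHypergraph

/-- The `a` cyclically consecutive vertices `i, i + 1, …, i + (a - 1)` (modulo `l`) on the cycle
with vertex set `Fin l`. -/
def cyclicInterval (l a : ℕ) (i : Fin l) : Finset (Fin l) :=
  Finset.univ.filter fun v => ∃ j < a, v.val = (i.val + j) % l

/-- The hyperweb with parameters `r`, `l`, `m = a - 1`: the `r`-uniform hypergraph on `l` vertices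
placed in a cycle whose edges are the `r`-sets contained in some `a = m + 1` cyclically
consecutive vertices. -/
def hyperweb (r l m : ℕ) : UniformHypergraph (Fin l) r where
  edges := (Finset.powersetCard r Finset.univ).filter fun e =>
    ∃ i : Fin l, e ⊆ cyclicInterval l (m + 1) i
  card_of_mem _ he := (Finset.mem_powersetCard.mp (Finset.mem_filter.mp he).1).2

/-- The individual inequalities of the linear description of `T(W, r + 1, r)`, where `W` is the
hyperweb with parameters `r`, `l`, `m = r`. -/
inductive HyperwebInequality (r l : ℕ) : Type
  | clique (Q : Finset (Fin l)) (hQ : Q ∈ (hyperweb r l r).cliques (r + 1))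
  | web
  | nonneg (e : (hyperweb r l r).edges)
  | edge (e : (hyperweb r l r).edges)

/-- The point `x` satisfies the given inequality. -/
def HyperwebInequality.Holds {r l : ℕ} (x : (hyperweb r l r).edges → ℝ) :
    HyperwebInequality r l → Prop
  | .clique Q _ => (hyperweb r l r).edgeSum x Q ≤ r
  | .web => ∑ e, x e ≤ (r : ℝ) * l - ⌈(l : ℝ) / 2⌉
  | .nonneg e => 0 ≤ x e
  | .edge e => x e ≤ 1

/-!
At an extreme point of the cube cut by clique inequalities, the fractional coordinates are
determined by the tight cliques that contain fractional edges, so there are at least as many such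
cliques as fractional edges. In the hyperweb every edge lies in at most two cliques, while
integrality of the right-hand sides gives each of these tight cliques at least two fractional edges.
By double counting, every fractional edge lies in exactly two of them, and the incidence matrix is
square and invertible.

The cliques are the intervals of `r + 1` consecutive vertices (with two further triangles in the
octahedron `r = 2`, `l = 6`), and two intervals share an edge only if they are consecutive. If `l`
is even, the cliques therefore have a proper 2-colouring; the corresponding vector of signs is in
the left kernel of the incidence matrix, so no edge is fractional.

If `l` is odd, consider the `r * l` slacks of the interval inequalities and of `x_e ≤ 1` for the
edges `e` in a single interval. They determine `x`, and the web inequality says that their sum is at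
least `1`. On the face where it is tight, `x` therefore lies in a simplex, whose vertices turn out
to be integral. Off this face, an extreme point with a fractional edge would have all these slacks
equal to `0`, violating the web inequality.
-/

section Convexity

open Filter Set Topology

theorem convex_subset_convexHull_of_extremePoints {V : Type*} [AddCommGroup V] [Module ℝ V]
    [TopologicalSpace V] [T2Space V] [IsTopologicalAddGroup V] [ContinuousSMul ℝ V]
    [LocallyConvexSpace ℝ V] {s t : Set V} (hcomp : IsCompact s) (hconv : Convex ℝ s)
    (ht : t.Finite) (hext : s.extremePoints ℝ ⊆ convexHull ℝ t) : s ⊆ convexHull ℝ t := by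
  rw [← closure_convexHull_extremePoints hcomp hconv]
  exact closure_minimal (convexHull_min hext (convex_convexHull ℝ t)) (ht.isClosed_convexHull ℝ)

theorem mem_extremePoints_of_inter_mem_nhds {V : Type*} [AddCommGroup V] [Module ℝ V]
    [TopologicalSpace V] [IsTopologicalAddGroup V] [ContinuousSMul ℝ V] {s u : Set V} {x : V}
    (hs : Convex ℝ s) (hu : u ∈ 𝓝 x) (hx : x ∈ (s ∩ u).extremePoints ℝ) :
    x ∈ s.extremePoints ℝ := by
  refine ⟨hx.1.1, fun y hy z hz hxyz => ?_⟩
  have eventually_mem (w : V) (hw : w ∈ s) :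
      ∀ᶠ t in 𝓝[>] (0 : ℝ), AffineMap.lineMap x w t ∈ s ∩ u := by
    have hcont : Tendsto (fun t : ℝ => AffineMap.lineMap x w t) (𝓝[>] 0) (𝓝 x) := by
      have : Continuous fun t : ℝ => (AffineMap.lineMap x w t : V) :=
        AffineMap.lineMap_continuous
      simpa using this.continuousAt.continuousWithinAt (s := Ioi (0 : ℝ)) (x := 0) |>.tendsto
    filter_upwards [hcont hu, Ioo_mem_nhdsGT (zero_lt_one' ℝ)] with t htu ht
    exact ⟨hs.lineMap_mem hx.1.1 hw ⟨ht.1.le, ht.2.le⟩, htu⟩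
  obtain ⟨t, ⟨hty, htz⟩, ht⟩ :=
    ((eventually_mem y hy).and (eventually_mem z hz) |>.and self_mem_nhdsWithin).exists
  have hxt : x ∈ openSegment ℝ (AffineMap.lineMap x y t) (AffineMap.lineMap x z t) := by
    obtain ⟨a, b, ha, hb, hab, rfl⟩ := hxyz
    refine ⟨a, b, ha, hb, hab, ?_⟩
    simp only [AffineMap.lineMap_apply_module]
    obtain rfl := eq_sub_of_add_eq hab
    module
  have hy' := hx.2 hty htz hxt
  simpa [AffineMap.lineMap_apply, ht.ne', sub_eq_zero] using hy'

theorem eq_zero_of_mem_extremePoints_halfSpaces {V ι : Type*} [AddCommGroup V] [Module ℝ V]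
    [Finite ι] {f : ι → V →ₗ[ℝ] ℝ} {c : ι → ℝ} {x d : V}
    (hx : x ∈ {y | ∀ i, f i y ≤ c i}.extremePoints ℝ) (hd : ∀ i, f i x = c i → f i d = 0) :
    d = 0 := by
  have eventually_mem (d' : V) (hd' : ∀ i, f i x = c i → f i d' = 0) :
      ∀ᶠ t in 𝓝[>] (0 : ℝ), ∀ i, f i (x + t • d') ≤ c i := by
    refine eventually_all.2 fun i => ?_
    rcases (hx.1 i).eq_or_lt with htight | hslack
    · simp [hd' i htight, htight]
    · have hcont : Continuous fun t : ℝ => f i (x + t • d') := by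
        simp only [map_add, map_smul]
        fun_prop
      exact ((hcont.tendsto' 0 (f i x) (by simp)).mono_left nhdsWithin_le_nhds).eventually_le_const
        hslack
  obtain ⟨t, ⟨hpos, hneg⟩, ht⟩ := ((eventually_mem d hd).and
    (eventually_mem (-d) fun i hi => by simp [hd i hi]) |>.and self_mem_nhdsWithin).exists
  have hmid : x ∈ openSegment ℝ (x + t • d) (x + t • -d) :=
    ⟨1 / 2, 1 / 2, by norm_num, by norm_num, by norm_num, by module⟩
  simpa [ht.ne'] using hx.2 hpos hneg hmid

theorem mem_convexHull_range_of_map_mem_stdSimplex {V ι : Type*} [AddCommGroup V] [Module ℝ V]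
    [Fintype ι] [DecidableEq ι] {Φ : V →ᵃ[ℝ] ι → ℝ} (hΦ : Function.Injective Φ) {v : ι → V}
    (hv : ∀ i, Φ (v i) = Pi.single i 1) {x : V} (hx : Φ x ∈ stdSimplex ℝ ι) :
    x ∈ convexHull ℝ (range v) := by
  have hrange : Φ '' range v = range fun i => Pi.single i (1 : ℝ) := by
    rw [← range_comp]
    exact congrArg range (funext hv)
  rwa [← convexHull_rangle_single_eq_stdSimplex, ← hrange, ← AffineMap.image_convexHull,
    hΦ.mem_set_image] at hx

theorem exists_ne_zero_one_of_sum_eq_int {E : Type*} {s : Finset E} {x : E → ℝ} {b : ℤ}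
    (hsum : ∑ e ∈ s, x e = b) {e : E} (he : e ∈ s) (hxe : x e ∈ Ioo 0 1) :
    ∃ e' ∈ s, e' ≠ e ∧ x e' ≠ 0 ∧ x e' ≠ 1 := by
  classical
  by_contra! hinteg
  have hrest : ∑ e' ∈ s.erase e, x e' ∈ (Int.castAddHom ℝ).range := by
    refine sum_mem fun e' he' => ?_
    by_cases h0 : x e' = 0
    · exact ⟨0, by simp [h0]⟩
    · exact ⟨1, by simp [hinteg e' (Finset.mem_of_mem_erase he') (Finset.ne_of_mem_erase he') h0]⟩
  obtain ⟨k, hk⟩ := hrest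
  have hxk : x e = ((b - k : ℤ) : ℝ) := by
    rw [← Finset.add_sum_erase s x he, ← hk] at hsum
    push_cast
    simpa using eq_sub_of_add_eq hsum
  obtain ⟨h0, h1⟩ := hxk ▸ hxe
  have : (0 : ℤ) < b - k := by exact_mod_cast h0
  have : b - k < (1 : ℤ) := by exact_mod_cast h1
  omega

end Convexity

section Incidence

open Finset

theorem vecMul_injective_of_mulVec_injective {m n K : Type*} [Fintype m] [Fintype n] [Field K]
    {A : Matrix m n K} (hcard : Fintype.card n = Fintype.card m)
    (hA : Function.Injective A.mulVec) : Function.Injective A.vecMul := by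
  rw [Matrix.mulVec_injective_iff] at hA
  rw [Matrix.vecMul_injective_iff, linearIndependent_iff_card_eq_finrank_span, Set.finrank,
    ← Matrix.rank_eq_finrank_span_row, ← Matrix.rank_transpose, ← hcard]
  exact (LinearIndependent.rank_matrix hA).symm

theorem card_eq_and_degree_eq_two {N E : Type*} [Fintype N] [Fintype E] {I : N → E → Prop}
    [DecidableRel I] (hcard : Fintype.card E ≤ Fintype.card N) (hle : ∀ e, #{n | I n e} ≤ 2)
    (hge : ∀ n, 2 ≤ #{e | I n e}) :
    Fintype.card E = Fintype.card N ∧ ∀ e, #{n | I n e} = 2 := by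
  have hdouble : ∑ n, #{e | I n e} = ∑ e, #{n | I n e} :=
    sum_card_bipartiteAbove_eq_sum_card_bipartiteBelow I
  have hlower : ∑ _n : N, 2 ≤ ∑ n, #{e | I n e} := sum_le_sum fun n _ => hge n
  have hupper : ∑ e, #{n | I n e} ≤ ∑ _e : E, 2 := sum_le_sum fun e _ => hle e
  simp only [sum_const, card_univ, smul_eq_mul] at hlower hupper
  refine ⟨by omega, fun e => (sum_eq_sum_iff_of_le fun e _ => hle e).1 ?_ e (mem_univ e)⟩
  simp only [sum_const, card_univ, smul_eq_mul]
  omega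

variable {N E : Type*}

/-- The polytope cut out of the unit cube `[0, 1]^E` by the inequalities `x(inc n) ≤ b n`, one for
each `n : N`. The right-hand sides are integers. -/
def incidencePolytope (inc : N → Finset E) (b : N → ℤ) : Set (E → ℝ) :=
  {x | (∀ n, ∑ e ∈ inc n, x e ≤ b n) ∧ ∀ e, 0 ≤ x e ∧ x e ≤ 1}

variable {inc : N → Finset E} {b : N → ℤ}

theorem convex_incidencePolytope : Convex ℝ (incidencePolytope inc b) := by
  rintro x ⟨hx, hx01⟩ y ⟨hy, hy01⟩ s t hs ht hst
  refine ⟨fun n => ?_, fun e => convex_Icc (0 : ℝ) 1 (hx01 e) (hy01 e) hs ht hst⟩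
  have hsum : ∑ e ∈ inc n, (s • x + t • y) e
      = s • ∑ e ∈ inc n, x e + t • ∑ e ∈ inc n, y e := by
    simp only [Pi.add_apply, Pi.smul_apply, sum_add_distrib, smul_sum]
  exact hsum ▸ convex_Iic (b n : ℝ) (hx n) (hy n) hs ht hst

theorem isCompact_incidencePolytope : IsCompact (incidencePolytope inc b) := by
  have hcube : IsCompact (Set.univ.pi fun _ : E => Set.Icc (0 : ℝ) 1) :=
    isCompact_univ_pi fun _ => isCompact_Icc
  have hclosed : IsClosed {x : E → ℝ | ∀ n, ∑ e ∈ inc n, x e ≤ b n} := by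
    simp only [Set.ofPred_forall]
    exact isClosed_iInter fun n => isClosed_le (by fun_prop) continuous_const
  convert hcube.inter_left hclosed using 1
  ext x
  simp only [incidencePolytope, Set.mem_inter_iff, Set.mem_univ_pi, Set.mem_Icc, Set.mem_ofPred_eq]

variable {x : E → ℝ}

theorem eq_zero_of_mem_extremePoints_incidencePolytope [Finite N] [Finite E]
    (hx : x ∈ (incidencePolytope inc b).extremePoints ℝ) {d : E → ℝ}
    (hinteg : ∀ e, x e ∉ Set.Ioo 0 1 → d e = 0)
    (htight : ∀ n, ∑ e ∈ inc n, x e = b n → ∑ e ∈ inc n, d e = 0) : d = 0 := by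
  let f : N ⊕ E ⊕ E → (E → ℝ) →ₗ[ℝ] ℝ :=
    Sum.elim (fun n => ∑ e ∈ inc n, LinearMap.proj e)
      (Sum.elim (fun e => -LinearMap.proj e) fun e => LinearMap.proj e)
  let c : N ⊕ E ⊕ E → ℝ := Sum.elim (fun n => b n) (Sum.elim (fun _ => 0) fun _ => 1)
  have hpoly : incidencePolytope inc b = {y | ∀ i, f i y ≤ c i} := by
    ext y
    simp [incidencePolytope, f, c, forall_and]
  refine eq_zero_of_mem_extremePoints_halfSpaces (hpoly ▸ hx) ?_
  rintro (n | e | e) h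
  · simpa [f] using htight n (by simpa [f, c] using h)
  · have : x e = 0 := by simpa [f, c] using h
    simpa [f] using hinteg e (by simp [this])
  · have : x e = 1 := by simpa [f, c] using h
    simpa [f] using hinteg e (by simp [this])

/-- The coordinates at which a point of the cube `[0, 1]^E` is not integral. -/
abbrev FractionalCoord (x : E → ℝ) : Type _ :=
  {e // x e ∈ Set.Ioo 0 1}

/-- The inequalities `x(inc n) ≤ b n` that are tight at `x` and involve a fractional coordinate. -/
abbrev TightRow (inc : N → Finset E) (b : N → ℤ) (x : E → ℝ) : Type _ :=
  {n // ∑ e ∈ inc n, x e = b n ∧ ∃ e ∈ inc n, x e ∈ Set.Ioo 0 1}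

/-- The incidence matrix between the tight rows and the fractional coordinates of `x`. -/
def tightIncidenceMatrix [DecidableEq E] (inc : N → Finset E) (b : N → ℤ) (x : E → ℝ) :
    Matrix (TightRow inc b x) (FractionalCoord x) ℝ :=
  Matrix.of fun n e => if e.1 ∈ inc n then 1 else 0

open Classical in
theorem tightIncidenceMatrix_mulVec_injective [Finite N] [Fintype E]
    (hx : x ∈ (incidencePolytope inc b).extremePoints ℝ) :
    Function.Injective (tightIncidenceMatrix inc b x).mulVec := by
  rw [← Matrix.coe_mulVecLin, ← LinearMap.ker_eq_bot, LinearMap.ker_eq_bot']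
  intro d hd
  let d' : E → ℝ := Function.extend Subtype.val d 0
  have hd'_coe (e : FractionalCoord x) : d' e = d e :=
    Subtype.val_injective.extend_apply d 0 e
  have hd'_int (e : E) (he : x e ∉ Set.Ioo 0 1) : d' e = 0 :=
    Function.extend_apply' _ _ _ fun ⟨e', he'⟩ => he (he' ▸ e'.2)
  have hd' : d' = 0 := by
    refine eq_zero_of_mem_extremePoints_incidencePolytope hx hd'_int fun n hn => ?_
    by_cases hmeet : ∃ e ∈ inc n, x e ∈ Set.Ioo 0 1
    · calc ∑ e ∈ inc n, d' e = ∑ e, if e ∈ inc n then d' e else 0 := by simp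
        _ = ∑ e : FractionalCoord x, if e.1 ∈ inc n then d e else 0 := by
          refine (Fintype.sum_of_injective _ Subtype.val_injective _ _ (fun e he => ?_)
            fun e => by rw [hd'_coe]).symm
          rw [hd'_int e (by simpa using he), ite_self]
        _ = 0 := by
          simpa [tightIncidenceMatrix, Matrix.mulVec, dotProduct] using congrFun hd ⟨n, hn, hmeet⟩
    · push Not at hmeet
      exact sum_eq_zero fun e he => hd'_int e (hmeet e he)
  funext e
  rw [← hd'_coe, hd', Pi.zero_apply, Pi.zero_apply]

open Classical in
theorem tightIncidenceMatrix_square [Fintype N] [Fintype E]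
    (hx : x ∈ (incidencePolytope inc b).extremePoints ℝ) (hdeg : ∀ e, #{n | e ∈ inc n} ≤ 2) :
    Fintype.card (FractionalCoord x) = Fintype.card (TightRow inc b x) ∧
      ∀ e : FractionalCoord x, #{n : TightRow inc b x | e.1 ∈ inc n} = 2 := by
  refine card_eq_and_degree_eq_two
    (I := fun (n : TightRow inc b x) (e : FractionalCoord x) => e.1 ∈ inc n) ?_ (fun e => ?_) ?_
  · have hinj : Function.Injective (tightIncidenceMatrix inc b x).mulVecLin :=
      tightIncidenceMatrix_mulVec_injective hx
    simpa using LinearMap.finrank_le_finrank_of_injective hinj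
  · refine le_trans (card_le_card_of_injOn Subtype.val ?_ Subtype.val_injective.injOn) (hdeg e)
    simp [Set.MapsTo]
  · rintro ⟨n, hn, e, he, hxe⟩
    obtain ⟨e', he', hne, h0, h1⟩ := exists_ne_zero_one_of_sum_eq_int hn he hxe
    have hxe' : x e' ∈ Set.Ioo 0 1 :=
      ⟨(hx.1.2 e').1.lt_of_ne' h0, (hx.1.2 e').2.lt_of_ne h1⟩
    exact one_lt_card.2 ⟨⟨e, hxe⟩, by simpa using he, ⟨e', hxe'⟩, by simpa using he',
      by simpa using hne.symm⟩

theorem degree_eq_two_and_tight_of_mem_extremePoints [Fintype N] [Finite E] [DecidableEq E]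
    (hx : x ∈ (incidencePolytope inc b).extremePoints ℝ)
    (hdeg : ∀ e, #{n | e ∈ inc n} ≤ 2) {e : E} (he : x e ∈ Set.Ioo 0 1) :
    #{n | e ∈ inc n} = 2 ∧ ∀ n, e ∈ inc n → ∑ e ∈ inc n, x e = b n := by
  classical
  have := Fintype.ofFinite E
  let rows : Finset N :=
    ({n | e ∈ inc n} : Finset (TightRow inc b x)).map (Function.Embedding.subtype _)
  have hrows : #rows = 2 := by
    rw [card_map]
    convert (tightIncidenceMatrix_square hx fun e => by convert hdeg e).2 ⟨e, he⟩
  have hsub : rows ⊆ ({n | e ∈ inc n} : Finset N) := by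
    intro n hn
    obtain ⟨m, hm, rfl⟩ := mem_map.1 hn
    exact (mem_filter_univ _).2 ((mem_filter_univ m).1 hm)
  have heq := eq_of_subset_of_card_le hsub (hrows ▸ hdeg e)
  refine ⟨heq ▸ hrows, fun n hn => ?_⟩
  obtain ⟨m, -, rfl⟩ := mem_map.1 (heq.symm ▸ (mem_filter_univ n).2 hn : n ∈ rows)
  exact m.2.1

open Classical in
theorem card_filter_le_two_of_coloring [Fintype N] {inc : N → Finset E} {color : N → Bool}
    (hcolor : ∀ e n m, e ∈ inc n → e ∈ inc m → n ≠ m → color n ≠ color m) (e : E) :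
    #{n | e ∈ inc n} ≤ 2 := by
  refine (card_le_card_of_injOn color (t := univ) (fun _ _ => mem_univ _)
    fun n hn m hm hnm => ?_).trans_eq Fintype.card_bool
  by_contra hne
  exact hcolor e n m (mem_filter.1 hn).2 (mem_filter.1 hm).2 hne hnm

theorem eq_zero_or_eq_one_of_coloring [Finite N] [Finite E] {color : N → Bool}
    (hcolor : ∀ e n m, e ∈ inc n → e ∈ inc m → n ≠ m → color n ≠ color m)
    (hx : x ∈ (incidencePolytope inc b).extremePoints ℝ) (e : E) : x e = 0 ∨ x e = 1 := by
  classical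
  have := Fintype.ofFinite N
  have := Fintype.ofFinite E
  by_contra! hfrac
  have hxe : x e ∈ Set.Ioo 0 1 :=
    ⟨(hx.1.2 e).1.lt_of_ne' hfrac.1, (hx.1.2 e).2.lt_of_ne hfrac.2⟩
  obtain ⟨hsquare, hdeg⟩ :=
    tightIncidenceMatrix_square hx (card_filter_le_two_of_coloring hcolor)
  let sign : TightRow inc b x → ℝ := fun n => if color n then 1 else -1
  have hkernel : Matrix.vecMul sign (tightIncidenceMatrix inc b x) = 0 := by
    funext e
    obtain ⟨n, m, hnm, hset⟩ := card_eq_two.1 (hdeg e)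
    have hn : n ∈ ({n, m} : Finset _) := by simp
    have hm : m ∈ ({n, m} : Finset _) := by simp
    rw [← hset, mem_filter] at hn hm
    have hne := hcolor e n m hn.2 hm.2 (Subtype.coe_injective.ne hnm)
    have hcol : ∑ k with e.1 ∈ inc k.1, sign k = sign n + sign m := by rw [hset, sum_pair hnm]
    have hcancel : sign n + sign m = 0 := by
      simp only [sign]
      cases hcn : color n <;> cases hcm : color m <;> simp_all
    simpa [Matrix.vecMul, dotProduct, tightIncidenceMatrix, sum_filter] using hcol.trans hcancel
  have hsign : sign = 0 :=
    vecMul_injective_of_mulVec_injective hsquare (tightIncidenceMatrix_mulVec_injective hx)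
      (hkernel.trans (Matrix.zero_vecMul _).symm)
  obtain ⟨n, -⟩ : Finset.Nonempty _ := card_pos.1 ((hdeg ⟨e, hxe⟩).symm ▸ two_pos)
  have := congrFun hsign n
  simp only [sign, Pi.zero_apply] at this
  split_ifs at this <;> norm_num at this

end Incidence

namespace UniformHypergraph

open Finset

variable {V : Type*} {r a : ℕ}

theorem filter_edges_subset_powersetCard [DecidableEq V] (H : UniformHypergraph V r)
    (Q : Finset V) : {e ∈ H.edges | e ⊆ Q} ⊆ powersetCard r Q := fun e he =>
  mem_powersetCard.2 ⟨(mem_filter.1 he).2, H.card_of_mem e (mem_filter.1 he).1⟩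

theorem card_filter_edges_of_mem_cliques [DecidableEq V] {H : UniformHypergraph V r} {Q : Finset V}
    (hQ : Q ∈ H.cliques a) : #{e ∈ H.edges | e ⊆ Q} = a.choose r := by
  rw [← hQ.1, ← card_powersetCard]
  congr 1
  refine (H.filter_edges_subset_powersetCard Q).antisymm fun e he => mem_filter.2 ⟨hQ.2 he, ?_⟩
  exact (mem_powersetCard.1 he).1

theorem card_filter_edges_lt_of_notMem_cliques [DecidableEq V] {H : UniformHypergraph V r}
    {Q : Finset V} (hcard : #Q = a) (hQ : Q ∉ H.cliques a) :
    #{e ∈ H.edges | e ⊆ Q} < a.choose r := by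
  rw [← hcard, ← card_powersetCard]
  refine card_lt_card ((H.filter_edges_subset_powersetCard Q).ssubset_of_ne fun heq => hQ ?_)
  exact ⟨hcard, heq ▸ filter_subset _ _⟩

theorem cliques_mono {F H : UniformHypergraph V r} (hFH : F.edges ⊆ H.edges) :
    F.cliques a ⊆ H.cliques a := fun _ hQ => ⟨hQ.1, hQ.2.trans hFH⟩

variable [DecidableEq V]

theorem edgeSum_eq_sum_filter (H : UniformHypergraph V r) (x : H.edges → ℝ) (S : Finset V) :
    H.edgeSum x S = ∑ e with e.1 ⊆ S, x e :=
  (sum_filter _ _).symm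

theorem sum_characteristic {F H : UniformHypergraph V r} (hFH : F.edges ⊆ H.edges) :
    ∑ e : H.edges, (if e.1 ∈ F.edges then (1 : ℝ) else 0) = #F.edges := by
  rw [sum_coe_sort H.edges fun e => if e ∈ F.edges then (1 : ℝ) else 0, sum_boole,
    filter_mem_eq_inter, inter_eq_right.2 hFH]

theorem edgeSum_characteristic {F H : UniformHypergraph V r} (hFH : F.edges ⊆ H.edges)
    (S : Finset V) :
    H.edgeSum (fun e => if e.1 ∈ F.edges then 1 else 0) S = #{e ∈ F.edges | e ⊆ S} := by
  simp only [edgeSum, ← ite_and]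
  rw [sum_coe_sort H.edges fun e => if e ⊆ S ∧ e ∈ F.edges then (1 : ℝ) else 0, sum_boole]
  congr 2
  grind

/-- The relaxation of the Turán polytope `T(H, a, r)` by the clique inequalities: a clique on `a`
vertices has `a.choose r` edges, not all of which may be chosen. -/
def cliquePolytope (H : UniformHypergraph V r) (a : ℕ) : Set (H.edges → ℝ) :=
  {x | (∀ Q ∈ H.cliques a, H.edgeSum x Q ≤ a.choose r - 1) ∧ ∀ e, 0 ≤ x e ∧ x e ≤ 1}

variable {H : UniformHypergraph V r} {x : H.edges → ℝ}

theorem cliquePolytope_eq_incidencePolytope {N : Type*} {cl : N → Finset V}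
    (hcl : Set.range cl = H.cliques a) :
    H.cliquePolytope a =
      incidencePolytope (fun n => {e : H.edges | e.1 ⊆ cl n}) fun _ => a.choose r - 1 := by
  ext x
  simp only [cliquePolytope, incidencePolytope, ← hcl, Set.forall_mem_range, edgeSum_eq_sum_filter,
    Set.mem_ofPred_eq]
  push_cast
  rfl

theorem convex_cliquePolytope : Convex ℝ (H.cliquePolytope a) := by
  rw [cliquePolytope_eq_incidencePolytope Subtype.range_val]
  exact convex_incidencePolytope

theorem isCompact_cliquePolytope : IsCompact (H.cliquePolytope a) := by
  rw [cliquePolytope_eq_incidencePolytope Subtype.range_val]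
  exact isCompact_incidencePolytope

theorem turanPolytope_subset_cliquePolytope : H.turanPolytope a ⊆ H.cliquePolytope a := by
  refine convexHull_min ?_ convex_cliquePolytope
  rintro _ ⟨F, hFH, hfree, rfl⟩
  refine ⟨fun Q hQ => ?_, fun e => by dsimp only; split_ifs <;> norm_num⟩
  have hlt : #{e ∈ F.edges | e ⊆ Q} < a.choose r :=
    card_filter_edges_lt_of_notMem_cliques hQ.1 (hfree ▸ Set.notMem_empty Q)
  rw [edgeSum_characteristic hFH, le_sub_iff_add_le]
  exact_mod_cast hlt

theorem mem_turanPolytope_of_integral (hx : x ∈ H.cliquePolytope a)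
    (hinteg : ∀ e, x e = 0 ∨ x e = 1) : x ∈ H.turanPolytope a := by
  classical
  let F : UniformHypergraph V r :=
    { edges := {e ∈ H.edges | ∃ he : e ∈ H.edges, x ⟨e, he⟩ = 1}
      card_of_mem := fun e he => H.card_of_mem e (mem_filter.1 he).1 }
  have hFH : F.edges ⊆ H.edges := filter_subset _ _
  have hchar : x = fun e => if e.1 ∈ F.edges then 1 else 0 := by
    funext e
    rcases hinteg e with he | he <;> simp [F, he]
  refine subset_convexHull ℝ _ ⟨F, hFH, Set.eq_empty_of_forall_notMem fun Q hQ => ?_, hchar⟩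
  have hle := hx.1 Q (cliques_mono hFH hQ)
  rw [hchar, edgeSum_characteristic hFH, card_filter_edges_of_mem_cliques hQ] at hle
  linarith

theorem subset_turanPolytope_of_extremePoints {s : Set (H.edges → ℝ)} (hcomp : IsCompact s)
    (hconv : Convex ℝ s) (hext : s.extremePoints ℝ ⊆ H.turanPolytope a) :
    s ⊆ H.turanPolytope a := by
  refine convex_subset_convexHull_of_extremePoints hcomp hconv ?_ hext
  refine (Set.Finite.pi' fun _ => Set.toFinite ({0, 1} : Set ℝ)).subset ?_
  rintro _ ⟨F, -, -, rfl⟩ e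
  by_cases he : e.1 ∈ F.edges <;> simp [he]

theorem turanPolytope_eq_cliquePolytope_of_coloring {N : Type*} [Finite N] {cl : N → Finset V}
    (hcl : Set.range cl = H.cliques a) {color : N → Bool}
    (hcolor : ∀ e ∈ H.edges, ∀ n m, e ⊆ cl n → e ⊆ cl m → n ≠ m → color n ≠ color m) :
    H.turanPolytope a = H.cliquePolytope a := by
  refine turanPolytope_subset_cliquePolytope.antisymm ?_
  refine subset_turanPolytope_of_extremePoints isCompact_cliquePolytope convex_cliquePolytope ?_
  intro x hx
  refine mem_turanPolytope_of_integral hx.1 ?_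
  rw [cliquePolytope_eq_incidencePolytope hcl] at hx
  refine eq_zero_or_eq_one_of_coloring (color := color) (fun e n m hn hm => ?_) hx
  exact hcolor e e.2 n m (mem_filter.1 hn).2 (mem_filter.1 hm).2

theorem sum_le_floor_of_mem_turanPolytope {c : ℝ} (hc : ∀ x ∈ H.cliquePolytope a, ∑ e, x e ≤ c)
    (hx : x ∈ H.turanPolytope a) : ∑ e, x e ≤ ⌊c⌋ := by
  have hconv : Convex ℝ {x : H.edges → ℝ | ∑ e, x e ≤ ⌊c⌋} := by
    refine convex_halfSpace_le ⟨fun x y => ?_, fun t x => ?_⟩ _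
    · simp [sum_add_distrib]
    · simp [mul_sum]
  refine convexHull_min ?_ hconv hx
  rintro _ ⟨F, hFH, hfree, rfl⟩
  have hle := hc _ (turanPolytope_subset_cliquePolytope
    (subset_convexHull ℝ _ ⟨F, hFH, hfree, rfl⟩))
  rw [sum_characteristic hFH] at hle
  rw [Set.mem_ofPred_eq, sum_characteristic hFH]
  exact_mod_cast Int.le_floor.2 (by exact_mod_cast hle)

end UniformHypergraph

section CyclicInterval

open Finset

variable {r l a : ℕ}

theorem mem_edges_hyperweb {e : Finset (Fin l)} :
    e ∈ (hyperweb r l r).edges ↔ #e = r ∧ ∃ i, e ⊆ cyclicInterval l (r + 1) i := by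
  simp [hyperweb, mem_powersetCard]

variable [NeZero l]

theorem mem_cyclicInterval {i v : Fin l} : v ∈ cyclicInterval l a i ↔ (v - i).val < a := by
  simp only [cyclicInterval, mem_filter, mem_univ, true_and]
  constructor
  · rintro ⟨j, hj, hv⟩
    refine lt_of_le_of_lt ?_ hj
    rw [Fin.val_sub, hv, Nat.add_mod_mod, ← add_assoc, Nat.sub_add_cancel i.is_lt.le,
      Nat.add_mod_left]
    exact Nat.mod_le _ _
  · intro h
    exact ⟨_, h, by rw [← Fin.val_add, add_sub_cancel]⟩

theorem card_cyclicInterval (ha : a ≤ l) (i : Fin l) : #(cyclicInterval l a i) = a := by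
  have hcard : #{v : Fin l | v.val < a} = a := by rw [Fin.card_filter_val_lt, min_eq_right ha]
  refine Eq.trans ?_ hcard
  refine card_bij' (fun v _ => v - i) (fun v _ => v + i) ?_ ?_ ?_ ?_ <;> simp [mem_cyclicInterval]

theorem arc_notMem_cyclicInterval {i v w : Fin l} (hv : v ∉ cyclicInterval l a i)
    (hw : w ∉ cyclicInterval l a i) :
    (∀ u, (u - v).val ≤ (w - v).val → u ∉ cyclicInterval l a i) ∨
      ∀ u, (w - v).val ≤ (u - v).val → u ∉ cyclicInterval l a i := by
  have val_sub_start (u : Fin l) := Fin.val_add_eq_ite (u - v) (v - i)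
  simp only [sub_add_sub_cancel] at val_sub_start
  have hw' := val_sub_start w
  simp only [mem_cyclicInterval, not_lt] at hv hw ⊢
  rcases le_or_gt (v - i).val (w - i).val with hle | hlt
  · refine .inl fun u hu => ?_
    have hu' := val_sub_start u
    grind
  · refine .inr fun u hu => ?_
    have hu' := val_sub_start u
    grind

theorem card_filter_notMem_cyclicInterval_le_two {Q : Finset (Fin l)} {j : Fin l → Fin l}
    (hj : ∀ w ∈ Q, Q.erase w ⊆ cyclicInterval l a (j w))
    (hj' : ∀ w ∈ Q, w ∉ cyclicInterval l a (j w)) (v : Fin l) :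
    #{w ∈ Q | v ∉ cyclicInterval l a (j w)} ≤ 2 := by
  by_contra! hcard
  set S := {w ∈ Q | v ∉ cyclicInterval l a (j w)}
  have hne : S.Nonempty := card_pos.1 (by omega)
  obtain ⟨w₁, hw₁, hmin⟩ := S.exists_min_image (fun w => (w - v).val) hne
  obtain ⟨w₂, hw₂, hmax⟩ := S.exists_max_image (fun w => (w - v).val) hne
  obtain ⟨w, hw, hw12⟩ :=
    exists_mem_notMem_of_card_lt_card (card_le_two.trans_lt hcard : #{w₁, w₂} < #S)
  simp only [mem_insert, mem_singleton, not_or] at hw12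
  have hwQ := (mem_filter.1 hw).1
  rcases arc_notMem_cyclicInterval (mem_filter.1 hw).2 (hj' w hwQ) with harc | harc
  · exact harc w₁ (hmin w hw) (hj w hwQ (mem_erase.2 ⟨Ne.symm hw12.1, (mem_filter.1 hw₁).1⟩))
  · exact harc w₂ (hmax w hw) (hj w hwQ (mem_erase.2 ⟨Ne.symm hw12.2, (mem_filter.1 hw₂).1⟩))

theorem cyclicInterval_mem_cliques (hl : r + 1 ≤ l) (i : Fin l) :
    cyclicInterval l (r + 1) i ∈ (hyperweb r l r).cliques (r + 1) :=
  ⟨card_cyclicInterval hl i, fun _ he =>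
    mem_edges_hyperweb.2 ⟨(mem_powersetCard.1 he).2, i, (mem_powersetCard.1 he).1⟩⟩

-- If a clique `Q` lies in no interval, the complements of the intervals around the sets `Q.erase w`
-- are arcs that meet `Q` only in `w`; no vertex lies in three of them, so they cannot be long.
theorem exists_subset_cyclicInterval_of_mem_cliques (hr : 2 ≤ r) (hl : 2 * (r + 1) ≤ l)
    (hocta : ¬(r = 2 ∧ l = 6)) {Q : Finset (Fin l)} (hQ : Q ∈ (hyperweb r l r).cliques (r + 1)) :
    ∃ i, Q ⊆ cyclicInterval l (r + 1) i := by
  by_contra! hno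
  have hedge (w : Fin l) (hw : w ∈ Q) : ∃ i, Q.erase w ⊆ cyclicInterval l (r + 1) i := by
    refine (mem_edges_hyperweb.1 (hQ.2 (mem_powersetCard.2 ⟨erase_subset w Q, ?_⟩))).2
    rw [card_erase_of_mem hw, hQ.1, Nat.add_sub_cancel]
  choose! j hj using hedge
  have hj' (w : Fin l) (hw : w ∈ Q) : w ∉ cyclicInterval l (r + 1) (j w) := fun hmem =>
    hno (j w) ((insert_erase hw).symm ▸ insert_subset hmem (hj w hw))
  have hdouble : ∑ w ∈ Q, #(cyclicInterval l (r + 1) (j w))ᶜ =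
      ∑ v, #{w ∈ Q | v ∉ cyclicInterval l (r + 1) (j w)} := by
    simp only [compl_eq_univ_sdiff, sdiff_eq_filter]
    exact sum_card_bipartiteAbove_eq_sum_card_bipartiteBelow _
  have hleft : ∑ w ∈ Q, #(cyclicInterval l (r + 1) (j w))ᶜ = (r + 1) * (l - (r + 1)) := by
    simp [card_compl, card_cyclicInterval (by omega : r + 1 ≤ l), hQ.1]
  have hmem (v : Fin l) (hv : v ∈ Q) : #{w ∈ Q | v ∉ cyclicInterval l (r + 1) (j w)} ≤ 1 := by
    refine card_le_one_iff_subset_singleton.2 ⟨v, fun w hw => mem_singleton.2 ?_⟩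
    by_contra hne
    exact (mem_filter.1 hw).2
      (hj w (mem_filter.1 hw).1 (mem_erase.2 ⟨Ne.symm hne, hv⟩))
  have hright : ∑ v, #{w ∈ Q | v ∉ cyclicInterval l (r + 1) (j w)} ≤
      (r + 1) + (l - (r + 1)) * 2 := by
    rw [← sum_add_sum_compl Q]
    refine add_le_add ?_ ?_
    · simpa [hQ.1] using sum_le_sum hmem
    · simpa [hQ.1, card_compl] using
        sum_le_sum fun v (_ : v ∈ Qᶜ) => card_filter_notMem_cyclicInterval_le_two hj hj' v
  obtain ⟨m, rfl⟩ : ∃ m, l = r + 1 + m := ⟨l - (r + 1), by omega⟩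
  rw [← hdouble, hleft, Nat.add_sub_cancel_left] at hright
  have : m ≤ 3 := by nlinarith
  have : r ≤ 2 := by omega
  omega

theorem range_cyclicInterval_eq_cliques (hr : 2 ≤ r) (hl : 2 * (r + 1) ≤ l)
    (hocta : ¬(r = 2 ∧ l = 6)) :
    Set.range (cyclicInterval l (r + 1)) = (hyperweb r l r).cliques (r + 1) := by
  have hl' : r + 1 ≤ l := by omega
  refine (Set.range_subset_iff.2 (cyclicInterval_mem_cliques hl')).antisymm fun Q hQ => ?_
  obtain ⟨i, hi⟩ := exists_subset_cyclicInterval_of_mem_cliques hr hl hocta hQ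
  exact ⟨i, (eq_of_subset_of_card_le hi (by rw [card_cyclicInterval hl', hQ.1])).symm⟩

end CyclicInterval

section WebEdge

open Finset

variable {r l k : ℕ} [NeZero l]

/-- The `r`-set obtained from the interval starting at `i` by deleting its vertex `i + k`. For
`k < r` every edge of the hyperweb arises exactly once; deleting the last vertex `i + r` leaves the
set obtained by deleting the first vertex of the preceding interval. -/
def webEdge (r : ℕ) (i : Fin l) (k : ℕ) : Finset (Fin l) :=
  (cyclicInterval l (r + 1) i).erase (i + Fin.ofNat l k)

theorem mem_webEdge (hk : k < l) {i v : Fin l} :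
    v ∈ webEdge r i k ↔ (v - i).val ≤ r ∧ (v - i).val ≠ k := by
  have hne : v ≠ i + Fin.ofNat l k ↔ (v - i).val ≠ k := by
    rw [ne_eq, ne_eq, ← sub_eq_iff_eq_add', Fin.ext_iff, Fin.val_ofNat, Nat.mod_eq_of_lt hk]
  rw [webEdge, mem_erase, mem_cyclicInterval, Nat.lt_succ_iff, hne, and_comm]

theorem val_sub_sub_one (hl : 2 ≤ l) (v i : Fin l) :
    (v - (i - 1)).val = if (v - i).val + 1 = l then 0 else (v - i).val + 1 := by
  have h1 : (1 : Fin l).val = 1 := by rw [Fin.val_one', Nat.mod_eq_of_lt hl]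
  rw [← sub_add, Fin.val_add_eq_ite, h1]
  have := (v - i).is_lt
  split_ifs <;> omega

theorem webEdge_eq_webEdge_sub_one (hl : r + 2 ≤ l) (i : Fin l) :
    webEdge r i r = webEdge r (i - 1) 0 := by
  ext v
  rw [mem_webEdge (by omega), mem_webEdge (by omega), val_sub_sub_one (by omega)]
  split_ifs <;> omega

theorem webEdge_mem_edges (hk : k ≤ r) (hl : r + 1 ≤ l) (i : Fin l) :
    webEdge r i k ∈ (hyperweb r l r).edges := by
  refine mem_edges_hyperweb.2 ⟨?_, i, erase_subset _ _⟩
  rw [webEdge, card_erase_of_mem, card_cyclicInterval hl, Nat.add_sub_cancel]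
  rw [mem_cyclicInterval, add_sub_cancel_left, Fin.val_ofNat, Nat.mod_eq_of_lt] <;> omega

theorem exists_eq_webEdge (hr : 1 ≤ r) (hl : r + 2 ≤ l) {e : Finset (Fin l)}
    (he : e ∈ (hyperweb r l r).edges) : ∃ i, ∃ k < r, webEdge r i k = e := by
  obtain ⟨hcard, i, hi⟩ := mem_edges_hyperweb.1 he
  have hdiff : #(cyclicInterval l (r + 1) i \ e) = 1 := by
    rw [card_sdiff_of_subset hi, card_cyclicInterval (by omega), hcard, Nat.add_sub_cancel_left]
  obtain ⟨w, hw⟩ := card_eq_one.1 hdiff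
  have hew : webEdge r i (w - i).val = e := by
    rw [webEdge, Fin.ofNat_val_eq_self, add_sub_cancel, ← sdiff_singleton_eq_erase, ← hw,
      Finset.sdiff_sdiff_eq_self hi]
  have hwi : (w - i).val < r + 1 :=
    mem_cyclicInterval.1 (sdiff_subset (hw ▸ mem_singleton_self w))
  rcases (Nat.lt_succ_iff.1 hwi).lt_or_eq with hlt | hlast
  · exact ⟨i, _, hlt, hew⟩
  · rw [hlast, webEdge_eq_webEdge_sub_one hl] at hew
    exact ⟨i - 1, 0, hr, hew⟩

theorem webEdge_subset_cyclicInterval_iff (hk : k < r) (hl : 2 * (r + 1) ≤ l) {i j : Fin l} :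
    webEdge r i k ⊆ cyclicInterval l (r + 1) j ↔ i = j ∨ i = j - 1 ∧ k = 0 := by
  constructor
  · intro hsub
    have offset (t : ℕ) (ht : t ≤ r) (htk : t ≠ k) : t + (i - j).val < r + 1 ∨
        l ≤ t + (i - j).val ∧ t + (i - j).val - l < r + 1 := by
      have hval : (Fin.ofNat l t).val = t := by
        rw [Fin.val_ofNat, Nat.mod_eq_of_lt (by omega)]
      have hmem : i + Fin.ofNat l t ∈ webEdge r i k := by
        rw [mem_webEdge (by omega), add_sub_cancel_left, hval]
        exact ⟨ht, htk⟩
      have hlt := mem_cyclicInterval.1 (hsub hmem)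
      rw [add_comm i, add_sub_assoc, Fin.val_add_eq_ite, hval] at hlt
      split_ifs at hlt <;> omega
    have hlast := offset r le_rfl hk.ne'
    rcases Nat.eq_zero_or_pos k with rfl | hkpos
    · have := offset 1 (by omega) one_ne_zero
      have := val_sub_sub_one (by omega) i j
      have hsplit : (i - j).val = 0 ∨ (i - (j - 1)).val = 0 := by
        split_ifs at this <;> omega
      simpa only [Fin.val_eq_zero_iff, sub_eq_zero, and_true] using hsplit
    · have := offset 0 (Nat.zero_le r) hkpos.ne
      refine .inl (sub_eq_zero.1 (Fin.ext ?_))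
      rw [Fin.val_zero]
      omega
  · rintro (rfl | ⟨rfl, rfl⟩)
    · exact erase_subset _ _
    · rw [← webEdge_eq_webEdge_sub_one (by omega)]
      exact erase_subset _ _

theorem sub_one_sub_one_ne (hl : 3 ≤ l) (i : Fin l) : i - 1 - 1 ≠ i := fun h => by
  have := val_sub_sub_one (by omega) i (i - 1)
  rw [h, val_sub_sub_one (by omega), sub_self, Fin.val_zero] at this
  split_ifs at this <;> omega

theorem webEdge_inj {i j : Fin l} {k m : ℕ} (hk : k < r) (hm : m < r) (hl : 2 * (r + 1) ≤ l)
    (h : webEdge r i k = webEdge r j m) : i = j ∧ k = m := by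
  have hij : i = j := by
    have hi := (webEdge_subset_cyclicInterval_iff hm hl).1 (h ▸ erase_subset _ _ :
      webEdge r j m ⊆ cyclicInterval l (r + 1) i)
    have hj := (webEdge_subset_cyclicInterval_iff hk hl).1 (h.symm ▸ erase_subset _ _ :
      webEdge r i k ⊆ cyclicInterval l (r + 1) j)
    rcases hi with rfl | ⟨rfl, -⟩
    · rfl
    · exact hj.resolve_right fun hi => sub_one_sub_one_ne (by omega) i hi.1.symm
  subst hij
  refine ⟨rfl, not_not.1 fun hkm => ?_⟩
  have hval : (Fin.ofNat l k).val = k := by rw [Fin.val_ofNat, Nat.mod_eq_of_lt (by omega)]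
  have hmem : i + Fin.ofNat l k ∈ webEdge r i m := by
    rw [mem_webEdge (by omega), add_sub_cancel_left, hval]
    exact ⟨by omega, hkm⟩
  rw [← h] at hmem
  exact notMem_erase _ _ hmem

variable [NeZero r]

/-- The parametrization of the edges of the hyperweb by the pairs `(i, k)` with `k < r`. The edges
`(i, 0)` are the intersections of two consecutive intervals, all others lie in one interval only. -/
noncomputable def webEdgeEquiv (hl : 2 * (r + 1) ≤ l) :
    Fin l × Fin r ≃ (hyperweb r l r).edges :=
  Equiv.ofBijective
    (fun p => ⟨webEdge r p.1 p.2, webEdge_mem_edges p.2.is_lt.le (by omega) p.1⟩)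
    ⟨fun p q h =>
      have hpq := webEdge_inj p.2.is_lt q.2.is_lt hl (Subtype.ext_iff.1 h)
      Prod.ext hpq.1 (Fin.ext hpq.2),
    fun e =>
      have ⟨i, k, hk, hik⟩ := exists_eq_webEdge NeZero.one_le (by omega) e.2
      ⟨(i, ⟨k, hk⟩), Subtype.ext hik⟩⟩

@[simp]
theorem coe_webEdgeEquiv (hl : 2 * (r + 1) ≤ l) (p : Fin l × Fin r) :
    (webEdgeEquiv hl p : Finset (Fin l)) = webEdge r p.1 p.2 :=
  rfl

theorem webEdgeEquiv_subset_iff (hl : 2 * (r + 1) ≤ l) {p : Fin l × Fin r} {j : Fin l} :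
    (webEdgeEquiv hl p : Finset (Fin l)) ⊆ cyclicInterval l (r + 1) j ↔
      p.1 = j ∨ p = (j - 1, 0) := by
  rw [coe_webEdgeEquiv, webEdge_subset_cyclicInterval_iff p.2.is_lt hl, Fin.val_eq_zero_iff,
    Prod.ext_iff]

theorem edgeSum_cyclicInterval (hl : 2 * (r + 1) ≤ l) (x : (hyperweb r l r).edges → ℝ)
    (j : Fin l) :
    (hyperweb r l r).edgeSum x (cyclicInterval l (r + 1) j) =
      ∑ k, x (webEdgeEquiv hl (j, k)) + x (webEdgeEquiv hl (j - 1, 0)) := by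
  have hr := Nat.pos_of_neZero r
  have hj : j - 1 ≠ j := fun h => sub_one_sub_one_ne (by omega) j (by rw [h, h])
  have hsplit (p : Fin l × Fin r) :
      (if (webEdgeEquiv hl p).1 ⊆ cyclicInterval l (r + 1) j then x (webEdgeEquiv hl p) else 0) =
        (if p.1 = j then x (webEdgeEquiv hl p) else 0) +
          if p = (j - 1, 0) then x (webEdgeEquiv hl p) else 0 := by
    rw [if_congr (webEdgeEquiv_subset_iff hl) rfl rfl]
    by_cases hp : p.1 = j
    · have : p ≠ (j - 1, 0) := fun h => hj ((congrArg Prod.fst h).symm.trans hp)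
      simp [hp, this]
    · simp [hp]
  rw [UniformHypergraph.edgeSum, ← (webEdgeEquiv hl).sum_comp, sum_congr rfl fun p _ => hsplit p,
    sum_add_distrib, sum_ite_eq' univ, if_pos (mem_univ _), Fintype.sum_prod_type_right]
  simp only [sum_ite_eq', mem_univ, if_true]

end WebEdge

section EvenCycle

open Finset

theorem cliquePolytope_hyperweb (r l : ℕ) :
    (hyperweb r l r).cliquePolytope (r + 1) =
      {x | (∀ Q ∈ (hyperweb r l r).cliques (r + 1), (hyperweb r l r).edgeSum x Q ≤ r) ∧
        ∀ e, 0 ≤ x e ∧ x e ≤ 1} := by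
  simp [UniformHypergraph.cliquePolytope, Nat.choose_succ_self_right]

/-- The triangles of the octahedron `hyperweb 2 6 2`: the six intervals, and the two triangles
`{0, 2, 4}` and `{1, 3, 5}`. No other hyperweb has cliques that are not intervals. -/
def octahedronTriangle : Fin 8 → Finset (Fin 6) :=
  ![{0, 1, 2}, {1, 2, 3}, {2, 3, 4}, {3, 4, 5}, {4, 5, 0}, {5, 0, 1}, {0, 2, 4}, {1, 3, 5}]

theorem range_octahedronTriangle : Set.range octahedronTriangle = (hyperweb 2 6 2).cliques 3 := by
  have htriangle : ∀ Q ∈ powersetCard 3 (univ : Finset (Fin 6)),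
      powersetCard 2 Q ⊆ (hyperweb 2 6 2).edges ↔ ∃ n, octahedronTriangle n = Q := by
    decide +kernel
  have hcard : ∀ n, #(octahedronTriangle n) = 3 := by decide
  ext Q
  constructor
  · rintro ⟨n, rfl⟩
    exact ⟨hcard n, (htriangle _ (mem_powersetCard.2 ⟨subset_univ _, hcard n⟩)).2 ⟨n, rfl⟩⟩
  · exact fun hQ => (htriangle Q (mem_powersetCard.2 ⟨subset_univ _, hQ.1⟩)).1 hQ.2

theorem turanPolytope_octahedron :
    (hyperweb 2 6 2).turanPolytope 3 = (hyperweb 2 6 2).cliquePolytope 3 :=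
  UniformHypergraph.turanPolytope_eq_cliquePolytope_of_coloring range_octahedronTriangle
    (color := ![true, false, true, false, true, false, false, true]) (by decide +kernel)

theorem turanPolytope_hyperweb_of_even {r l : ℕ} [NeZero l] (hr : 2 ≤ r) (hl : 2 * (r + 1) ≤ l)
    (heven : Even l) :
    (hyperweb r l r).turanPolytope (r + 1) = (hyperweb r l r).cliquePolytope (r + 1) := by
  by_cases hocta : r = 2 ∧ l = 6
  · obtain ⟨rfl, rfl⟩ := hocta
    exact turanPolytope_octahedron
  refine UniformHypergraph.turanPolytope_eq_cliquePolytope_of_coloring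
    (range_cyclicInterval_eq_cliques hr hl hocta)
    (color := fun i => decide (Even (0 - i).val)) fun e he n m hn hm hnm => ?_
  have color_sub_one (i : Fin l) : Even (0 - (i - 1)).val ↔ ¬Even (0 - i).val := by
    rw [val_sub_sub_one (by omega)]
    grind
  obtain ⟨i, k, hk, rfl⟩ := exists_eq_webEdge (by omega) (by omega) he
  rw [webEdge_subset_cyclicInterval_iff hk hl] at hn hm
  have hconsec : n = m - 1 ∨ m = n - 1 := by grind
  rw [ne_eq, decide_eq_decide]
  rcases hconsec with rfl | rfl
  · have := color_sub_one m
    tauto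
  · have := color_sub_one n
    tauto

end EvenCycle

section Slack

open Finset

variable {r l : ℕ} [NeZero l] [NeZero r]

/-- The slacks at `x` of the interval inequalities, at the index `(i, 0)`, and of the inequalities
`x_e ≤ 1` for the edges that lie in one interval only, at the indices `(i, k)` with `k ≠ 0`. -/
noncomputable def webSlack (hl : 2 * (r + 1) ≤ l) :
    ((hyperweb r l r).edges → ℝ) →ᵃ[ℝ] Fin l × Fin r → ℝ :=
  AffineMap.pi fun p =>
    if p.2 = 0 then
      AffineMap.const ℝ _ (r : ℝ) -
        (∑ e with e.1 ⊆ cyclicInterval l (r + 1) p.1, LinearMap.proj e :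
          ((hyperweb r l r).edges → ℝ) →ₗ[ℝ] ℝ).toAffineMap
    else AffineMap.const ℝ _ 1 - (LinearMap.proj (webEdgeEquiv hl p)).toAffineMap

variable {hl : 2 * (r + 1) ≤ l} {x : (hyperweb r l r).edges → ℝ}

theorem webSlack_zero (i : Fin l) : webSlack hl x (i, 0) =
    r - (hyperweb r l r).edgeSum x (cyclicInterval l (r + 1) i) := by
  simp [webSlack, UniformHypergraph.edgeSum_eq_sum_filter]

theorem webSlack_of_ne_zero (i : Fin l) {k : Fin r} (hk : k ≠ 0) :
    webSlack hl x (i, k) = 1 - x (webEdgeEquiv hl (i, k)) := by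
  simp [webSlack, hk]

theorem webSlack_zero_add_one (i : Fin l) :
    webSlack hl x (i, 0) + 1 = (1 - x (webEdgeEquiv hl (i, 0))) +
      (1 - x (webEdgeEquiv hl (i - 1, 0))) + ∑ k ∈ univ.erase 0, webSlack hl x (i, k) := by
  have hcard : ((#(univ.erase (0 : Fin r)) : ℕ) : ℝ) = r - 1 := by
    rw [card_erase_of_mem (mem_univ _), card_univ, Fintype.card_fin,
      Nat.cast_sub (Nat.pos_of_neZero r), Nat.cast_one]
  rw [sum_congr rfl fun k hk => webSlack_of_ne_zero i (ne_of_mem_erase hk), sum_sub_distrib,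
    sum_const, nsmul_one, hcard, webSlack_zero, edgeSum_cyclicInterval hl,
    ← add_sum_erase univ _ (mem_univ 0)]
  ring

theorem sum_webSlack : ∑ p, webSlack hl x p = (2 * r - 1) * l - 2 * ∑ e, x e := by
  have hrow (i : Fin l) : ∑ k, webSlack hl x (i, k) = (2 * r - 1) -
      2 * ∑ k, x (webEdgeEquiv hl (i, k)) +
        (x (webEdgeEquiv hl (i, 0)) - x (webEdgeEquiv hl (i - 1, 0))) := by
    rw [← add_sum_erase univ _ (mem_univ 0)]
    have hstar := webSlack_zero_add_one (hl := hl) (x := x) i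
    rw [webSlack_zero, edgeSum_cyclicInterval hl] at hstar ⊢
    linarith
  have htelescope :
      ∑ i, (x (webEdgeEquiv hl (i, 0)) - x (webEdgeEquiv hl (i - 1, 0))) = 0 := by
    rw [sum_sub_distrib, sub_eq_zero]
    exact ((Equiv.subRight 1).sum_comp fun i => x (webEdgeEquiv hl (i, 0))).symm
  rw [Fintype.sum_prod_type, sum_congr rfl fun i _ => hrow i, sum_add_distrib, htelescope, add_zero,
    sum_sub_distrib, ← mul_sum, ← Fintype.sum_prod_type', (webEdgeEquiv hl).sum_comp x]
  simp
  ring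

theorem webSlack_nonneg (hx : x ∈ (hyperweb r l r).cliquePolytope (r + 1)) (p : Fin l × Fin r) :
    0 ≤ webSlack hl x p := by
  rw [cliquePolytope_hyperweb] at hx
  obtain ⟨i, k⟩ := p
  rcases eq_or_ne k 0 with rfl | hk
  · rw [webSlack_zero, sub_nonneg]
    exact hx.1 _ (cyclicInterval_mem_cliques (by omega) i)
  · rw [webSlack_of_ne_zero i hk, sub_nonneg]
    exact (hx.2 _).2

theorem sum_le_of_mem_turanPolytope_hyperweb (hl : 2 * (r + 1) ≤ l)
    (hx : x ∈ (hyperweb r l r).turanPolytope (r + 1)) :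
    ∑ e, x e ≤ (r : ℝ) * l - ⌈(l : ℝ) / 2⌉ := by
  have hbound (y) (hy : y ∈ (hyperweb r l r).cliquePolytope (r + 1)) :
      ∑ e, y e ≤ ((r * l : ℕ) : ℝ) + -((l : ℝ) / 2) := by
    have hnonneg := sum_nonneg fun p (_ : p ∈ univ) => webSlack_nonneg (hl := hl) hy p
    rw [sum_webSlack] at hnonneg
    push_cast
    linarith
  have := UniformHypergraph.sum_le_floor_of_mem_turanPolytope hbound hx
  rw [Int.floor_natCast_add, Int.floor_neg] at this
  push_cast at this
  linarith

end Slack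

section OddVertices

open Finset

theorem eq_zero_of_antiperiodic_of_odd_nsmul_eq_zero {G M : Type*} [AddMonoid G] [AddGroup M]
    [IsAddTorsionFree M] {f : G → M} {c : G} {n : ℕ} (hf : Function.Antiperiodic f c) (hn : Odd n)
    (hc : n • c = 0) : f = 0 := by
  obtain ⟨m, rfl⟩ := hn
  funext i
  have := hf.odd_nsmul_antiperiodic m i
  rw [hc, add_zero] at this
  exact self_eq_neg.1 this

variable {r l : ℕ} [NeZero l]

theorem injective_webSlack [NeZero r] {hl : 2 * (r + 1) ≤ l} (hodd : Odd l) :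
    Function.Injective (webSlack hl) := by
  intro x y hxy
  have hshared :
      (fun i : Fin l => x (webEdgeEquiv hl (i, 0)) - y (webEdgeEquiv hl (i, 0))) = 0 := by
    refine eq_zero_of_antiperiodic_of_odd_nsmul_eq_zero (c := 1) (fun i => ?_) hodd ?_
    · have hx := webSlack_zero_add_one (hl := hl) (x := x) (i + 1)
      have hy := webSlack_zero_add_one (hl := hl) (x := y) (i + 1)
      rw [hxy, hy, add_sub_cancel_right] at hx
      linarith
    · simpa using card_nsmul_eq_zero' (G := Fin l) (x := 1)
  funext e
  obtain ⟨⟨i, k⟩, rfl⟩ := (webEdgeEquiv hl).surjective e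
  rcases eq_or_ne k 0 with rfl | hk
  · exact sub_eq_zero.1 (congrFun hshared i)
  · have := congrFun hxy (i, k)
    rwa [webSlack_of_ne_zero i hk, webSlack_of_ne_zero i hk, sub_right_inj] at this

/-- The vector on the cycle that alternates between `1` and `0`, starting with a `1` at `i`. For
odd `l` it ends with a second `1` at `i - 1`. -/
def alternatingVector (i j : Fin l) : ℝ :=
  if Even (j - i).val then 1 else 0

theorem alternatingVector_add_sub_one (hl : 2 ≤ l) (hodd : Odd l) (i j : Fin l) :
    alternatingVector i j + alternatingVector i (j - 1) = if j = i then 2 else 1 := by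
  have hstep := val_sub_sub_one hl (j - 1) i
  rw [sub_sub_sub_cancel_right] at hstep
  have hij : j = i ↔ (j - i).val = 0 := by rw [Fin.val_eq_zero_iff, sub_eq_zero]
  have hparity : Even (j - i).val ↔ ((j - i).val = 0 ∨ ¬Even (j - 1 - i).val) := by
    split_ifs at hstep <;> grind
  have hzero : (j - i).val = 0 → Even (j - 1 - i).val := by
    split_ifs at hstep <;> grind
  rw [alternatingVector, alternatingVector, if_congr hij rfl rfl]
  grind

variable [NeZero r]

/-- For odd `l`, the point at which the inequality with index `p` has slack `1` and all others are
tight. -/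
noncomputable def webVertex (hl : 2 * (r + 1) ≤ l) (p : Fin l × Fin r)
    (e : (hyperweb r l r).edges) : ℝ :=
  if ((webEdgeEquiv hl).symm e).2 = 0 then
    if p.2 = 0 then 1 - alternatingVector p.1 ((webEdgeEquiv hl).symm e).1
    else alternatingVector p.1 ((webEdgeEquiv hl).symm e).1
  else if (webEdgeEquiv hl).symm e = p then 0 else 1

variable {hl : 2 * (r + 1) ≤ l}

theorem webVertex_zero (p : Fin l × Fin r) (i : Fin l) :
    webVertex hl p (webEdgeEquiv hl (i, 0)) =
      if p.2 = 0 then 1 - alternatingVector p.1 i else alternatingVector p.1 i := by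
  simp [webVertex]

theorem webVertex_of_ne_zero (p : Fin l × Fin r) (i : Fin l) {k : Fin r} (hk : k ≠ 0) :
    webVertex hl p (webEdgeEquiv hl (i, k)) = if (i, k) = p then 0 else 1 := by
  simp [webVertex, hk]

theorem webVertex_eq_zero_or_eq_one (p : Fin l × Fin r) (e : (hyperweb r l r).edges) :
    webVertex hl p e = 0 ∨ webVertex hl p e = 1 := by
  unfold webVertex alternatingVector
  split_ifs <;> simp

theorem webSlack_webVertex (hodd : Odd l) (p : Fin l × Fin r) :
    webSlack hl (webVertex hl p) = Pi.single p 1 := by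
  have hne_zero (i : Fin l) {k : Fin r} (hk : k ≠ 0) :
      webSlack hl (webVertex hl p) (i, k) = if (i, k) = p then 1 else 0 := by
    rw [webSlack_of_ne_zero i hk, webVertex_of_ne_zero p i hk]
    split_ifs <;> norm_num
  funext ⟨i, k⟩
  rw [Pi.single_apply]
  rcases ne_or_eq k 0 with hk | rfl
  · exact hne_zero i hk
  · have hsum : ∑ k ∈ univ.erase 0, webSlack hl (webVertex hl p) (i, k) =
        if i = p.1 ∧ p.2 ≠ 0 then 1 else 0 := by
      rw [sum_congr rfl fun k hk => hne_zero i (ne_of_mem_erase hk)]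
      obtain ⟨j, m⟩ := p
      by_cases hij : i = j <;> simp [hij]
    have hstar := webSlack_zero_add_one (hl := hl) (x := webVertex hl p) i
    have halt := alternatingVector_add_sub_one (by omega) hodd p.1 i
    rw [hsum, webVertex_zero, webVertex_zero] at hstar
    rw [if_congr Prod.ext_iff rfl rfl]
    grind

end OddVertices

section OddCycle

open Finset

variable {r l : ℕ} [NeZero l]

theorem cliquePolytope_eq_incidencePolytope_cyclicInterval (hr : 2 ≤ r) (hl : 2 * (r + 1) ≤ l)
    (hodd : Odd l) : (hyperweb r l r).cliquePolytope (r + 1) =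
      incidencePolytope (fun i => {e | e.1 ⊆ cyclicInterval l (r + 1) i}) fun _ => (r : ℤ) := by
  rw [UniformHypergraph.cliquePolytope_eq_incidencePolytope
    (range_cyclicInterval_eq_cliques hr hl (by grind))]
  simp [Nat.choose_succ_self_right]

variable [NeZero r] {hl : 2 * (r + 1) ≤ l} {x : (hyperweb r l r).edges → ℝ}

theorem mem_cliquePolytope_of_webSlack_nonneg (hr : 2 ≤ r) (hodd : Odd l)
    (hslack : ∀ i, 0 ≤ webSlack hl x (i, 0)) (hx : ∀ e, 0 ≤ x e ∧ x e ≤ 1) :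
    x ∈ (hyperweb r l r).cliquePolytope (r + 1) := by
  rw [cliquePolytope_hyperweb, ← range_cyclicInterval_eq_cliques hr hl (by grind)]
  refine ⟨Set.forall_mem_range.2 fun i => ?_, hx⟩
  simpa [webSlack_zero] using hslack i

theorem webVertex_mem_turanPolytope (hr : 2 ≤ r) (hodd : Odd l) (p : Fin l × Fin r) :
    webVertex hl p ∈ (hyperweb r l r).turanPolytope (r + 1) := by
  refine UniformHypergraph.mem_turanPolytope_of_integral
    (mem_cliquePolytope_of_webSlack_nonneg (hl := hl) hr hodd (fun i => ?_) fun e => ?_)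
    (webVertex_eq_zero_or_eq_one p)
  · rw [webSlack_webVertex hodd, Pi.single_apply]
    split_ifs <;> norm_num
  · rcases webVertex_eq_zero_or_eq_one (hl := hl) p e with h | h <;> norm_num [h]

theorem mem_turanPolytope_of_sum_webSlack_eq_one (hr : 2 ≤ r) (hodd : Odd l)
    (hx : x ∈ (hyperweb r l r).cliquePolytope (r + 1)) (hsum : ∑ p, webSlack hl x p = 1) :
    x ∈ (hyperweb r l r).turanPolytope (r + 1) := by
  have hconv := mem_convexHull_range_of_map_mem_stdSimplex (injective_webSlack hodd)
    (webSlack_webVertex hodd) ⟨webSlack_nonneg hx, hsum⟩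
  exact convexHull_min (Set.range_subset_iff.2 (webVertex_mem_turanPolytope hr hodd))
    (convex_convexHull ℝ _) hconv

theorem filter_webEdgeEquiv_subset_cyclicInterval (p : Fin l × Fin r) :
    ({i | (webEdgeEquiv hl p).1 ⊆ cyclicInterval l (r + 1) i} : Finset (Fin l)) =
      if p.2 = 0 then {p.1, p.1 + 1} else {p.1} := by
  ext i
  rw [mem_filter_univ, webEdgeEquiv_subset_iff hl, Prod.ext_iff]
  split_ifs <;> grind

theorem webSlack_zero_eq_zero_of_mem_extremePoints (hr : 2 ≤ r) (hodd : Odd l)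
    (hx : x ∈ ((hyperweb r l r).cliquePolytope (r + 1)).extremePoints ℝ) {i : Fin l} {k : Fin r}
    (hfrac : x (webEdgeEquiv hl (i, k)) ∈ Set.Ioo 0 1) : k = 0 ∧ webSlack hl x (i, 0) = 0 := by
  rw [cliquePolytope_eq_incidencePolytope_cyclicInterval hr hl hodd] at hx
  have hdeg (e : (hyperweb r l r).edges) :
      #{i | e ∈ ({e | e.1 ⊆ cyclicInterval l (r + 1) i} : Finset (hyperweb r l r).edges)} ≤ 2 := by
    obtain ⟨p, rfl⟩ := (webEdgeEquiv hl).surjective e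
    simp only [mem_filter_univ]
    rw [filter_webEdgeEquiv_subset_cyclicInterval]
    split_ifs
    exacts [card_le_two, by simp]
  obtain ⟨htwo, htight⟩ := degree_eq_two_and_tight_of_mem_extremePoints hx hdeg hfrac
  simp only [mem_filter_univ] at htwo htight
  rw [filter_webEdgeEquiv_subset_cyclicInterval] at htwo
  constructor
  · by_contra hk
    simp [hk] at htwo
  · rw [webSlack_zero, UniformHypergraph.edgeSum_eq_sum_filter, sub_eq_zero, eq_comm]
    exact htight i ((webEdgeEquiv_subset_iff hl).2 (.inl rfl))

theorem mem_Ioo_sub_one_of_mem_extremePoints (hr : 2 ≤ r) (hodd : Odd l)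
    (hx : x ∈ ((hyperweb r l r).cliquePolytope (r + 1)).extremePoints ℝ) {i : Fin l}
    (hi : x (webEdgeEquiv hl (i, 0)) ∈ Set.Ioo 0 1) :
    x (webEdgeEquiv hl (i - 1, 0)) ∈ Set.Ioo 0 1 := by
  have htight := (webSlack_zero_eq_zero_of_mem_extremePoints hr hodd hx hi).2
  rw [webSlack_zero, sub_eq_zero, eq_comm, UniformHypergraph.edgeSum_eq_sum_filter] at htight
  have hmem : webEdgeEquiv hl (i, 0) ∈
      ({e | e.1 ⊆ cyclicInterval l (r + 1) i} : Finset (hyperweb r l r).edges) :=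
    (mem_filter_univ _).2 ((webEdgeEquiv_subset_iff hl).2 (.inl rfl))
  obtain ⟨e, he, hne, h0, h1⟩ := exists_ne_zero_one_of_sum_eq_int (b := r) htight hmem hi
  obtain ⟨⟨j, k⟩, rfl⟩ := (webEdgeEquiv hl).surjective e
  have hfrac : x (webEdgeEquiv hl (j, k)) ∈ Set.Ioo 0 1 :=
    ⟨(hx.1.2 _).1.lt_of_ne' h0, (hx.1.2 _).2.lt_of_ne h1⟩
  obtain rfl : k = 0 := (webSlack_zero_eq_zero_of_mem_extremePoints hr hodd hx hfrac).1
  rcases (webEdgeEquiv_subset_iff hl).1 (mem_filter.1 he).2 with hji | hji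
  · exact absurd (congrArg (fun i => webEdgeEquiv hl (i, 0)) hji) hne
  · rwa [hji] at hfrac

theorem forall_of_sub_one {n : ℕ} [NeZero n] (hn : 2 ≤ n) {P : Fin n → Prop}
    (hP : ∀ i, P i → P (i - 1)) {i : Fin n} (hi : P i) (j : Fin n) : P j := by
  induction hd : (i - j).val generalizing j with
  | zero => rwa [← sub_eq_zero.1 (Fin.val_eq_zero_iff.1 hd)]
  | succ d ih =>
    have hstep := val_sub_sub_one hn i (j + 1)
    rw [add_sub_cancel_right] at hstep
    have := hP _ (ih (j + 1) (by split_ifs at hstep <;> omega))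
    rwa [add_sub_cancel_right] at this

theorem webSlack_eq_zero_of_mem_extremePoints (hr : 2 ≤ r) (hodd : Odd l)
    (hx : x ∈ ((hyperweb r l r).cliquePolytope (r + 1)).extremePoints ℝ)
    {e : (hyperweb r l r).edges} (he : x e ∈ Set.Ioo 0 1) : webSlack hl x = 0 := by
  obtain ⟨⟨i, k⟩, rfl⟩ := (webEdgeEquiv hl).surjective e
  obtain rfl : k = 0 := (webSlack_zero_eq_zero_of_mem_extremePoints hr hodd hx he).1
  have hshared (j : Fin l) : x (webEdgeEquiv hl (j, 0)) ∈ Set.Ioo 0 1 :=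
    forall_of_sub_one (P := fun i => x (webEdgeEquiv hl (i, 0)) ∈ Set.Ioo 0 1) (by omega)
      (fun _ => mem_Ioo_sub_one_of_mem_extremePoints hr hodd hx) he j
  have hslack (j : Fin l) : webSlack hl x (j, 0) = 0 :=
    (webSlack_zero_eq_zero_of_mem_extremePoints hr hodd hx (hshared j)).2
  funext ⟨j, k⟩
  rcases eq_or_ne k 0 with rfl | hk
  · exact hslack j
  have hle : webSlack hl x (j, k) ≤ ∑ k ∈ univ.erase 0, webSlack hl x (j, k) :=
    single_le_sum (f := fun k => webSlack hl x (j, k)) (fun k _ => webSlack_nonneg hx.1 (j, k))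
      (mem_erase.2 ⟨hk, mem_univ k⟩)
  have hlt : webSlack hl x (j, k) < 1 := by
    have := webSlack_zero_add_one (hl := hl) (x := x) j
    rw [hslack] at this
    linarith [(hshared j).2, (hshared (j - 1)).2]
  rw [webSlack_of_ne_zero j hk] at hlt ⊢
  have hpos : 0 < x (webEdgeEquiv hl (j, k)) := by linarith
  have hge : 1 ≤ x (webEdgeEquiv hl (j, k)) := not_lt.1 fun h =>
    hk (webSlack_zero_eq_zero_of_mem_extremePoints hr hodd hx ⟨hpos, h⟩).1
  exact sub_eq_zero.2 (hge.antisymm (hx.1.2 _).2)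

theorem sum_webSlack_of_odd (hodd : Odd l) :
    ∑ p, webSlack hl x p = 1 + 2 * ((r : ℝ) * l - ⌈(l : ℝ) / 2⌉ - ∑ e, x e) := by
  obtain ⟨m, rfl⟩ := hodd
  have hceil : ⌈((2 * m + 1 : ℕ) : ℝ) / 2⌉ = (m : ℤ) + 1 := by
    rw [Int.ceil_eq_iff]
    push_cast
    constructor <;> linarith
  rw [sum_webSlack, hceil]
  push_cast
  ring

theorem turanPolytope_hyperweb_of_odd (hr : 2 ≤ r) (hl : 2 * (r + 1) ≤ l) (hodd : Odd l) :
    (hyperweb r l r).turanPolytope (r + 1) = (hyperweb r l r).cliquePolytope (r + 1) ∩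
      {x | ∑ e, x e ≤ (r : ℝ) * l - ⌈(l : ℝ) / 2⌉} := by
  have hcont : Continuous fun x : (hyperweb r l r).edges → ℝ => ∑ e, x e := by fun_prop
  have hconv : Convex ℝ
      {x : (hyperweb r l r).edges → ℝ | ∑ e, x e ≤ (r : ℝ) * l - ⌈(l : ℝ) / 2⌉} :=
    convex_halfSpace_le ⟨by simp [sum_add_distrib], by simp [mul_sum]⟩ _
  refine Set.Subset.antisymm (fun x hx =>
    ⟨UniformHypergraph.turanPolytope_subset_cliquePolytope hx,
      sum_le_of_mem_turanPolytope_hyperweb hl hx⟩) ?_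
  refine UniformHypergraph.subset_turanPolytope_of_extremePoints
    (UniformHypergraph.isCompact_cliquePolytope.inter_right (isClosed_le hcont continuous_const))
    (UniformHypergraph.convex_cliquePolytope.inter hconv) fun x hx => ?_
  have hsum := sum_webSlack_of_odd (hl := hl) (x := x) hodd
  rcases eq_or_lt_of_le (α := ℝ) hx.1.2 with htight | hstrict
  · rw [htight, sub_self, mul_zero, add_zero] at hsum
    exact mem_turanPolytope_of_sum_webSlack_eq_one hr hodd hx.1.1 hsum
  have hx' := mem_extremePoints_of_inter_mem_nhds UniformHypergraph.convex_cliquePolytope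
    (hcont.continuousAt.eventually_le_const hstrict) hx
  refine UniformHypergraph.mem_turanPolytope_of_integral hx.1.1 fun e => ?_
  by_contra! hfrac
  have hzero : webSlack hl x = 0 := webSlack_eq_zero_of_mem_extremePoints hr hodd hx'
    ⟨(hx.1.1.2 e).1.lt_of_ne' hfrac.1, (hx.1.1.2 e).2.lt_of_ne hfrac.2⟩
  simp only [hzero, Pi.zero_apply, sum_const_zero] at hsum
  linarith

end OddCycle

namespace HyperwebInequality

open Finset

variable {r l : ℕ}

theorem holds_clique_single (hr : 2 ≤ r) (Q hQ) (e : (hyperweb r l r).edges) {c : ℝ} (hc : c ≤ 2) :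
    (clique Q hQ).Holds (Pi.single e c) := by
  have hr' : (2 : ℝ) ≤ r := by exact_mod_cast hr
  have hsum : (hyperweb r l r).edgeSum (Pi.single e c) Q = if e.1 ⊆ Q then c else 0 := by
    simp [UniformHypergraph.edgeSum_eq_sum_filter, sum_pi_single']
  rw [Holds, hsum]
  split_ifs <;> linarith

theorem holds_web_single (hr : 2 ≤ r) (hl : 2 * (r + 1) ≤ l) (e : (hyperweb r l r).edges) {c : ℝ}
    (hc : c ≤ 2) : (web : HyperwebInequality r l).Holds (Pi.single e c) := by
  have hr' : (2 : ℝ) ≤ r := by exact_mod_cast hr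
  have hl' : (2 : ℝ) ≤ l := by exact_mod_cast (by omega : 2 ≤ l)
  have hceil : (⌈(l : ℝ) / 2⌉ : ℝ) ≤ l := by
    exact_mod_cast Int.ceil_le.2 (by push_cast; linarith : (l : ℝ) / 2 ≤ (l : ℤ))
  rw [Holds, sum_pi_single', if_pos (mem_univ e)]
  nlinarith

theorem exists_violating_only_nonneg (hr : 2 ≤ r) (hl : 2 * (r + 1) ≤ l)
    (e : (hyperweb r l r).edges) : ∃ x, ¬(nonneg e).Holds x ∧ ∀ j, j ≠ nonneg e → j.Holds x := by
  refine ⟨Pi.single e (-1), by norm_num [Holds], ?_⟩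
  rintro (⟨Q, hQ⟩ | _ | f | f) hne
  · exact holds_clique_single hr Q hQ e (by norm_num)
  · exact holds_web_single hr hl e (by norm_num)
  · have hfe : f ≠ e := fun h => hne (by rw [h])
    rw [Holds, Pi.single_eq_of_ne hfe]
  · rw [Holds, Pi.single_apply]
    split_ifs <;> norm_num

theorem exists_violating_only_edge (hr : 2 ≤ r) (hl : 2 * (r + 1) ≤ l)
    (e : (hyperweb r l r).edges) : ∃ x, ¬(edge e).Holds x ∧ ∀ j, j ≠ edge e → j.Holds x := by
  refine ⟨Pi.single e 2, by norm_num [Holds], ?_⟩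
  rintro (⟨Q, hQ⟩ | _ | f | f) hne
  · exact holds_clique_single hr Q hQ e le_rfl
  · exact holds_web_single hr hl e le_rfl
  · rw [Holds, Pi.single_apply]
    split_ifs <;> norm_num
  · have hfe : f ≠ e := fun h => hne (by rw [h])
    rw [Holds, Pi.single_eq_of_ne hfe]
    exact zero_le_one

variable [NeZero l] {x : (hyperweb r l r).edges → ℝ}

theorem holds_of_mem_turanPolytope [NeZero r] (hl : 2 * (r + 1) ≤ l)
    (hx : x ∈ (hyperweb r l r).turanPolytope (r + 1)) (i : HyperwebInequality r l) : i.Holds x := by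
  have hclique := UniformHypergraph.turanPolytope_subset_cliquePolytope hx
  rw [cliquePolytope_hyperweb] at hclique
  cases i with
  | clique Q hQ => exact hclique.1 Q hQ
  | web => exact sum_le_of_mem_turanPolytope_hyperweb hl hx
  | nonneg e => exact (hclique.2 e).1
  | edge e => exact (hclique.2 e).2

theorem holds_clique_iff [NeZero r] (hl : 2 * (r + 1) ≤ l) {i : Fin l} (hi) :
    (clique (r := r) (cyclicInterval l (r + 1) i) hi).Holds x ↔ 0 ≤ webSlack hl x (i, 0) := by
  rw [Holds, webSlack_zero, sub_nonneg]

theorem holds_web_iff [NeZero r] (hl : 2 * (r + 1) ≤ l) (hodd : Odd l) :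
    (web : HyperwebInequality r l).Holds x ↔ 1 ≤ ∑ p, webSlack hl x p := by
  rw [Holds, sum_webSlack_of_odd hodd]
  constructor <;> intro h <;> linarith

theorem exists_webSlack_zero_eq_neg_one (hr : 2 ≤ r) [NeZero r] (hl : 2 * (r + 1) ≤ l)
    (i : Fin l) :
    ∃ x, (∀ e, 0 ≤ x e ∧ x e ≤ 1) ∧ (∀ j, webSlack hl x (j, 0) = if j = i then -1 else 0) ∧
      ∀ j, ∑ m, webSlack hl x (j, m) = if j = i then -1 else 1 := by
  obtain ⟨k, hk⟩ : ∃ k : Fin r, k ≠ 0 := ⟨⟨1, hr⟩, fun h => by simpa using congrArg Fin.val h⟩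
  let x (e : (hyperweb r l r).edges) : ℝ :=
    if ((webEdgeEquiv hl).symm e).1 ≠ i ∧ ((webEdgeEquiv hl).symm e).2 = k then 0 else 1
  have hslack_of_ne_zero (j : Fin l) {m : Fin r} (hm : m ≠ 0) :
      webSlack hl x (j, m) = if m = k then (if j = i then 0 else 1) else 0 := by
    rw [webSlack_of_ne_zero j hm]
    dsimp only [x]
    rw [Equiv.symm_apply_apply]
    grind
  have hrow (j : Fin l) :
      ∑ m ∈ univ.erase 0, webSlack hl x (j, m) = if j = i then 0 else 1 := by
    rw [sum_congr rfl fun m hm => hslack_of_ne_zero j (ne_of_mem_erase hm)]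
    simp [hk]
  have hslack_zero (j : Fin l) : webSlack hl x (j, 0) = if j = i then -1 else 0 := by
    have hstar := webSlack_zero_add_one (hl := hl) (x := x) j
    rw [hrow] at hstar
    have hone (m : Fin l) : x (webEdgeEquiv hl (m, 0)) = 1 := by simp [x, hk.symm]
    rw [hone, hone] at hstar
    grind
  refine ⟨x, fun e => ?_, hslack_zero, fun j => ?_⟩
  · dsimp only [x]
    split_ifs <;> norm_num
  · rw [← add_sum_erase univ _ (mem_univ 0), hrow, hslack_zero]
    split_ifs <;> norm_num

theorem exists_violating_only_clique (hr : 2 ≤ r) (hl : 2 * (r + 1) ≤ l) (hodd : Odd l)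
    (Q : Finset (Fin l)) (hQ : Q ∈ (hyperweb r l r).cliques (r + 1)) :
    ∃ x, ¬(clique Q hQ).Holds x ∧ ∀ j, j ≠ clique Q hQ → j.Holds x := by
  have : NeZero r := ⟨by omega⟩
  have hrange := range_cyclicInterval_eq_cliques hr hl (by grind)
  obtain ⟨i, rfl⟩ := hrange.symm.subset hQ
  obtain ⟨x, hx01, hslack, hrow⟩ := exists_webSlack_zero_eq_neg_one hr hl i
  refine ⟨x, by simp [holds_clique_iff hl, hslack], ?_⟩
  rintro (⟨Q', hQ'⟩ | _ | e | e) hne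
  · obtain ⟨j, rfl⟩ := hrange.symm.subset hQ'
    have hji : j ≠ i := fun h => hne (by subst h; rfl)
    simp [holds_clique_iff hl, hslack, hji]
  · have hrow' (j : Fin l) : ∑ m, webSlack hl x (j, m) = 1 - if j = i then 2 else 0 := by
      rw [hrow]
      split_ifs <;> norm_num
    rw [holds_web_iff hl hodd, Fintype.sum_prod_type, sum_congr rfl fun j _ => hrow' j]
    simp only [sum_sub_distrib, sum_const, card_univ, Fintype.card_fin, sum_ite_eq',
      mem_univ, if_true, nsmul_one]
    have : (6 : ℝ) ≤ l := by exact_mod_cast (by omega : 6 ≤ l)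
    linarith
  · exact (hx01 e).1
  · exact (hx01 e).2

theorem exists_violating_only_web (hr : 2 ≤ r) (hl : 2 * (r + 1) ≤ l) (hodd : Odd l) :
    ∃ x, ¬(web : HyperwebInequality r l).Holds x ∧ ∀ j, j ≠ web → j.Holds x := by
  have : NeZero r := ⟨by omega⟩
  let x (e : (hyperweb r l r).edges) : ℝ := if ((webEdgeEquiv hl).symm e).2 = 0 then 1 / 2 else 1
  have hx01 (e) : 0 ≤ x e ∧ x e ≤ 1 := by
    dsimp only [x]
    split_ifs <;> norm_num
  have hslack_of_ne_zero (j : Fin l) {m : Fin r} (hm : m ≠ 0) : webSlack hl x (j, m) = 0 := by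
    simp [webSlack_of_ne_zero j hm, x, hm]
  have hslack_zero (j : Fin l) : webSlack hl x (j, 0) = 0 := by
    have hstar := webSlack_zero_add_one (hl := hl) (x := x) j
    have hhalf (m : Fin l) : x (webEdgeEquiv hl (m, 0)) = 1 / 2 := by simp [x]
    rw [sum_eq_zero fun m hm => hslack_of_ne_zero j (ne_of_mem_erase hm), hhalf, hhalf] at hstar
    linarith
  refine ⟨x, ?_, ?_⟩
  · rw [holds_web_iff hl hodd, sum_eq_zero]
    · norm_num
    · rintro ⟨j, m⟩ -
      rcases eq_or_ne m 0 with rfl | hm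
      exacts [hslack_zero j, hslack_of_ne_zero j hm]
  · rintro (⟨Q, hQ⟩ | _ | e | e) hne
    · obtain ⟨j, rfl⟩ := (range_cyclicInterval_eq_cliques hr hl (by grind)).symm.subset hQ
      exact (holds_clique_iff hl hQ).2 (hslack_zero j).ge
    · exact absurd rfl hne
    · exact (hx01 e).1
    · exact (hx01 e).2

theorem exists_violating_only (hr : 2 ≤ r) (hl : 2 * (r + 1) ≤ l) (hodd : Odd l) :
    ∀ i : HyperwebInequality r l, ∃ x, ¬i.Holds x ∧ ∀ j, j ≠ i → j.Holds x
  | clique Q hQ => exists_violating_only_clique hr hl hodd Q hQ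
  | web => exists_violating_only_web hr hl hodd
  | nonneg e => exists_violating_only_nonneg hr hl e
  | edge e => exists_violating_only_edge hr hl e

end HyperwebInequality

theorem turanPolytope_hyperweb {r l : ℕ} (hr : 2 ≤ r) (hl : 2 * (r + 1) ≤ l) :
    (hyperweb r l r).turanPolytope (r + 1) = (hyperweb r l r).cliquePolytope (r + 1) ∩
      {x | ∑ e, x e ≤ (r : ℝ) * l - ⌈(l : ℝ) / 2⌉} := by
  have : NeZero r := ⟨by omega⟩
  have : NeZero l := ⟨by omega⟩
  rcases Nat.even_or_odd l with heven | hodd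
  · rw [← turanPolytope_hyperweb_of_even hr hl heven, eq_comm, Set.inter_eq_left]
    exact fun x hx => sum_le_of_mem_turanPolytope_hyperweb hl hx
  · exact turanPolytope_hyperweb_of_odd hr hl hodd

theorem mainTheorem12 (r l : ℕ) (hr : 2 ≤ r) (hl : 2 * (r + 1) ≤ l) :
    (hyperweb r l r).turanPolytope (r + 1) =
        {x | (∀ Q ∈ (hyperweb r l r).cliques (r + 1), (hyperweb r l r).edgeSum x Q ≤ r) ∧
          ∑ e, x e ≤ (r : ℝ) * l - ⌈(l : ℝ) / 2⌉ ∧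
          ∀ e, 0 ≤ x e ∧ x e ≤ 1} ∧
      (Odd l → ∀ i : HyperwebInequality r l,
        ∃ x, x ∉ (hyperweb r l r).turanPolytope (r + 1) ∧
          ∀ j : HyperwebInequality r l, j ≠ i → j.Holds x) := by
  have : NeZero r := ⟨by omega⟩
  have : NeZero l := ⟨by omega⟩
  constructor
  · rw [turanPolytope_hyperweb hr hl, cliquePolytope_hyperweb]
    ext x
    exact and_right_comm.trans and_assoc
  · intro hodd i
    obtain ⟨x, hviolated, hothers⟩ := HyperwebInequality.exists_violating_only hr hl hodd i
    exact ⟨x, fun hx => hviolated (HyperwebInequality.holds_of_mem_turanPolytope hl hx i), hothers⟩
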